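/- For a real number $a$ and an integer $n\ge 0$ let $(a)_n = a(a+1)\cdots(a+n-1)$, with $(a)_0=1$, denote the Pochhammer symbol (rising factorial). Then the following two series converge absolutely, with the indicated sums: $$\sum_{n\ge 0} \frac{(1/2)_n^7}{(1)_n^7}\,\frac{1}{2^{6n}}\,\bigl(168n^3+76n^2+14n+1\bigr) = \frac{32}{\pi^3},$$ $$\sum_{n\ge 1} \frac{(1)_n^7}{(1/2)_n^7}\,\frac{1}{2^{6n}}\,\frac{21n^3-22n^2+8n-1}{n^7} = \frac{\pi^4}{8}.$$ -/

import Mathlib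

/-- The Pochhammer symbol (rising factorial) `(a)_n = a (a + 1) ⋯ (a + n - 1)`, with `(a)_0 = 1`. -/
noncomputable def pochhammerSymbol (a : ℝ) (n : ℕ) : ℝ :=
  (ascPochhammer ℝ n).eval a

/-!
Both series are evaluated by the Wilf–Zeilberger method: the summand is deformed by a parameter in
such a way that its difference at consecutive parameter values telescopes in the summation index, so
the sum has period `1` in the parameter.

For `1 / π ^ 3` the parameter is a natural number `k`. As `k → ∞` only the term `n = 0` survives,
and Wallis' product evaluates its limit.

For `π ^ 4` the parameter is a complex number `x`. On the strip `|re x| < 1` the sum is holomorphic,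
and it is bounded for `|re x| ≤ 1 / 2`; by periodicity it extends to a bounded entire function, so
it is constant by Liouville's theorem. At `x = 0` it is a multiple of the series in question, while
at `x = 1 / 2` only the term `n = 0` is nonzero.
-/

open Filter Topology

theorem pochhammerSymbol_zero (a : ℝ) : pochhammerSymbol a 0 = 1 := by
  rw [pochhammerSymbol, ascPochhammer_zero, Polynomial.eval_one]

theorem pochhammerSymbol_succ (a : ℝ) (n : ℕ) :
    pochhammerSymbol a (n + 1) = pochhammerSymbol a n * (a + n) :=
  ascPochhammer_succ_eval n a

theorem pochhammerSymbol_pos {a : ℝ} (ha : 0 < a) (n : ℕ) : 0 < pochhammerSymbol a n :=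
  ascPochhammer_pos n a ha

theorem pochhammerSymbol_one (n : ℕ) : pochhammerSymbol 1 n = n.factorial :=
  ascPochhammer_eval_one ℝ n

theorem pochhammerSymbol_two_mul (a : ℝ) (n : ℕ) :
    pochhammerSymbol (2 * a) (2 * n) =
      4 ^ n * pochhammerSymbol a n * pochhammerSymbol (a + 1 / 2) n := by
  induction n with
  | zero => simp only [mul_zero, pochhammerSymbol_zero, pow_zero, mul_one]
  | succ n ih =>
    simp only [Nat.mul_succ, pochhammerSymbol_succ, ih]
    push_cast
    ring

theorem factorial_two_mul_eq_pochhammerSymbol_half (n : ℕ) :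
    ((2 * n).factorial : ℝ) = 4 ^ n * pochhammerSymbol (1 / 2) n * n.factorial := by
  have h := pochhammerSymbol_two_mul (1 / 2) n
  norm_num only [pochhammerSymbol_one] at h
  exact h

theorem mul_ascPochhammer_eval_add_one {S : Type*} [CommSemiring S] (n : ℕ) (a : S) :
    a * (ascPochhammer S n).eval (a + 1) = (ascPochhammer S n).eval a * (a + n) := by
  rw [← ascPochhammer_succ_eval, ascPochhammer_succ_left, Polynomial.eval_mul, Polynomial.eval_X,
    Polynomial.eval_comp, Polynomial.eval_add, Polynomial.eval_X, Polynomial.eval_one]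

theorem mul_ascPochhammer_eval_add_two {S : Type*} [CommSemiring S] (n : ℕ) (a : S) :
    a * (a + 1) * (ascPochhammer S n).eval (a + 2) =
      (ascPochhammer S n).eval a * ((a + n) * (a + n + 1)) := by
  calc _ = a * ((a + 1) * (ascPochhammer S n).eval (a + 1 + 1)) := by
        rw [add_assoc a 1 1, one_add_one_eq_two, mul_assoc]
    _ = a * (ascPochhammer S n).eval (a + 1) * (a + n + 1) := by
        rw [mul_ascPochhammer_eval_add_one]
        ring
    _ = _ := by rw [mul_ascPochhammer_eval_add_one, mul_assoc]

theorem pochhammerSymbol_half_succ (n : ℕ) :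
    pochhammerSymbol (1 / 2) (n + 1) = pochhammerSymbol (3 / 2) n / 2 := by
  have h := mul_ascPochhammer_eval_add_one n (1 / 2 : ℝ)
  rw [show (1 / 2 : ℝ) + 1 = 3 / 2 by norm_num] at h
  rw [pochhammerSymbol_succ, pochhammerSymbol, pochhammerSymbol]
  linarith

theorem ofReal_pochhammerSymbol (a : ℝ) (n : ℕ) :
    (pochhammerSymbol a n : ℂ) = (ascPochhammer ℂ n).eval (a : ℂ) := by
  induction n with
  | zero => simp [pochhammerSymbol_zero]
  | succ n ih => rw [pochhammerSymbol_succ, ascPochhammer_succ_eval, ← ih]; push_cast; rfl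

theorem summable_natCast_add_one_pow_mul_geometric {R : Type*} [NormedCommRing R]
    [CompleteSpace R] (p : ℕ) {r : R} (hr : ‖r‖ < 1) :
    Summable fun n : ℕ => ((n : R) + 1) ^ p * r ^ n := by
  simp only [add_pow, one_pow, mul_one, Finset.sum_mul]
  refine summable_sum fun m _ => ?_
  exact ((summable_pow_mul_geometric_of_norm_lt_one m hr).mul_left (p.choose m : R)).congr
    fun n => by ring

theorem tsum_eq_tsum_of_sub_eq_telescoping {E : Type*} [AddCommGroup E] [TopologicalSpace E]
    [IsTopologicalAddGroup E] [T2Space E] {a b c : ℕ → E} (ha : Summable a) (hb : Summable b)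
    (habc : ∀ n, a n - b n = c (n + 1) - c n) (hc₀ : c 0 = 0) (hc : Tendsto c atTop (𝓝 0)) :
    ∑' n, a n = ∑' n, b n := by
  rw [← sub_eq_zero, ← ha.tsum_sub hb]
  refine tendsto_nhds_unique (ha.sub hb).hasSum.tendsto_sum_nat ?_
  simpa only [habc, Finset.sum_range_sub, hc₀, sub_zero] using hc

theorem hasSum_tsum_limit_of_wz_equation {E : Type*} [NormedAddCommGroup E] [CompleteSpace E]
    {F G : ℕ → ℕ → E} {g : ℕ → E} {u : ℕ → ℝ}
    (hwz : ∀ n k, G n (k + 1) - G n k = F (n + 1) k - F n k) (hF₀ : ∀ k, F 0 k = 0)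
    (hF : ∀ k, Tendsto (F · k) atTop (𝓝 0)) (hu : Summable u) (hGu : ∀ n k, ‖G n k‖ ≤ u n)
    (hg : ∀ n, Tendsto (G n) atTop (𝓝 (g n))) :
    HasSum (G · 0) (∑' n, g n) := by
  have hG (k : ℕ) : Summable (G · k) := .of_norm_bounded hu (hGu · k)
  have hconst (k : ℕ) : ∑' n, G n k = ∑' n, G n 0 := by
    induction k with
    | zero => rfl
    | succ k ih =>
      rw [← ih]
      exact tsum_eq_tsum_of_sub_eq_telescoping (hG _) (hG _) (hwz · k) (hF₀ k) (hF k)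
  have hlim : Tendsto (fun k => ∑' n, G n k) atTop (𝓝 (∑' n, g n)) :=
    tendsto_tsum_of_dominated_convergence hu hg (.of_forall fun k n => hGu n k)
  simp only [hconst] at hlim
  rw [← tendsto_nhds_unique tendsto_const_nhds hlim]
  exact (hG 0).hasSum

section complexNorm

variable {z : ℂ} {s t : ℝ}

theorem ne_zero_of_re_pos (hz : 0 < z.re) : z ≠ 0 := by
  rintro rfl
  exact hz.ne rfl

theorem ne_neg_natCast_of_re_pos (hz : 0 < z.re) (n : ℕ) : z ≠ -n := by
  rintro rfl
  rw [Complex.neg_re, Complex.natCast_re] at hz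
  linarith [n.cast_nonneg (α := ℝ)]

theorem norm_ofReal_sub_le_norm_ofReal_sub (hst : s ≤ t) (hz : z.re ≤ (s + t) / 2) :
    ‖(s - z : ℂ)‖ ≤ ‖(t - z : ℂ)‖ := by
  rw [← sq_le_sq₀ (norm_nonneg _) (norm_nonneg _), Complex.sq_norm, Complex.sq_norm,
    Complex.normSq_apply, Complex.normSq_apply]
  simp only [Complex.sub_re, Complex.sub_im, Complex.ofReal_re, Complex.ofReal_im]
  nlinarith

theorem norm_ofReal_sq_sub_sq_le_norm_ofReal_sq_sub_sq (hst : s ≤ t)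
    (hz : |z.re| ≤ (s + t) / 2) : ‖(s ^ 2 - z ^ 2 : ℂ)‖ ≤ ‖(t ^ 2 - z ^ 2 : ℂ)‖ := by
  have hz' := abs_le.1 hz
  rw [sq_sub_sq, sq_sub_sq, norm_mul, norm_mul, ← sub_neg_eq_add, ← sub_neg_eq_add]
  gcongr <;> apply norm_ofReal_sub_le_norm_ofReal_sub hst
  · rw [Complex.neg_re]
    linarith
  · exact hz'.2

theorem ofReal_sq_sub_sq_ne_zero (hz : |z.re| < s) : (s ^ 2 - z ^ 2 : ℂ) ≠ 0 := by
  have hz' := abs_lt.1 hz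
  rw [sq_sub_sq]
  refine mul_ne_zero (ne_zero_of_re_pos ?_) (ne_zero_of_re_pos ?_)
  · rw [Complex.add_re, Complex.ofReal_re]
    linarith
  · rw [Complex.sub_re, Complex.ofReal_re]
    linarith

theorem abs_sinh_im_le_norm_sin (z : ℂ) : |Real.sinh z.im| ≤ ‖Complex.sin z‖ := by
  have hsin : Complex.sin z = ((Real.sin z.re * Real.cosh z.im : ℝ) : ℂ) +
      ((Real.cos z.re * Real.sinh z.im : ℝ) : ℂ) * Complex.I := by
    rw [Complex.sin_eq]
    push_cast
    rfl
  rw [← sq_le_sq₀ (abs_nonneg _) (norm_nonneg _), sq_abs, Complex.sq_norm, hsin,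
    Complex.normSq_add_mul_I]
  nlinarith [Real.cosh_sq z.im, Real.sin_sq_add_cos_sq z.re, sq_nonneg (Real.sin z.re)]

theorem norm_cos_sq_le (z : ℂ) : ‖Complex.cos z‖ ^ 2 ≤ 1 + ‖Complex.sin z‖ ^ 2 := by
  rw [← norm_pow, Complex.cos_sq', ← norm_pow]
  exact (norm_sub_le _ _).trans_eq (by rw [norm_one])

theorem one_le_norm_sin_pi_mul {z : ℂ} (hz : 1 ≤ |z.im|) : 1 ≤ ‖Complex.sin (Real.pi * z)‖ := by
  calc (1 : ℝ) ≤ Real.pi * |z.im| := by nlinarith [Real.pi_gt_three]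
    _ ≤ Real.sinh (Real.pi * |z.im|) := Real.self_le_sinh_iff.2 (by positivity)
    _ = |Real.sinh (Real.pi * z).im| := by
      rw [Complex.im_ofReal_mul, Real.abs_sinh, abs_mul, abs_of_pos Real.pi_pos]
    _ ≤ _ := abs_sinh_im_le_norm_sin _

end complexNorm

theorem differentiableAt_Gamma_of_re_pos {z : ℂ} (hz : 0 < z.re) :
    DifferentiableAt ℂ Complex.Gamma z :=
  Complex.differentiableAt_Gamma z (ne_neg_natCast_of_re_pos hz)

theorem Gamma_natCast_add {z : ℂ} (hz : 0 < z.re) (n : ℕ) :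
    Complex.Gamma (n + z) = Complex.Gamma z * (ascPochhammer ℂ n).eval z := by
  rw [← Complex.Gamma_add_nat_div_Gamma_eq z (ne_neg_natCast_of_re_pos hz),
    mul_div_cancel₀ _ (Complex.Gamma_ne_zero_of_re_pos hz), add_comm]

theorem Gamma_one_half_sq : Complex.Gamma (1 / 2) ^ 2 = Real.pi := by
  have h := Complex.Gamma_mul_Gamma_one_sub (1 / 2)
  rw [show (1 : ℂ) - 1 / 2 = 1 / 2 by norm_num, mul_one_div, Complex.sin_pi_div_two] at h
  rw [sq, h, div_one]

theorem Gamma_three_halves : Complex.Gamma (3 / 2) = Complex.Gamma (1 / 2) / 2 := by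
  rw [show (3 / 2 : ℂ) = 1 / 2 + 1 by norm_num, Complex.Gamma_add_one _ (by norm_num)]
  ring

section strip

variable {E : Type*} {f : ℂ → E}

theorem apply_sub_intCast_eq_of_periodic_on_strip
    (hf : ∀ z : ℂ, -1 < z.re → z.re < 0 → f (z + 1) = f z) {z : ℂ} {m n : ℤ}
    (hm : |z.re - m| < 1) (hn : |z.re - n| < 1) : f (z - m) = f (z - n) := by
  wlog hmn : m ≤ n generalizing m n
  · exact (this hn hm (le_of_not_ge hmn)).symm
  obtain ⟨hm₁, hm₂⟩ := abs_lt.1 hm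
  obtain ⟨hn₁, hn₂⟩ := abs_lt.1 hn
  have hlt : n < m + 2 := by
    have : (n : ℝ) < m + 2 := by linarith
    exact_mod_cast this
  obtain rfl | rfl : n = m ∨ n = m + 1 := by lia
  · rfl
  · push_cast at hn₁ hn₂ ⊢
    have hre : (z - (m + 1)).re = z.re - (m + 1) := by
      rw [Complex.sub_re, Complex.add_re, Complex.intCast_re, Complex.one_re]
    rw [← hf (z - (m + 1)) (by rwa [hre]) (by linarith)]
    congr 1
    ring

/-- The function of period `1` that agrees with `f` on the strip `-1/2 ≤ re z < 1/2`. -/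
noncomputable def stripPeriodization (f : ℂ → E) (z : ℂ) : E := f (z - round z.re)

theorem stripPeriodization_apply (hf : ∀ z : ℂ, -1 < z.re → z.re < 0 → f (z + 1) = f z)
    {z : ℂ} {m : ℤ} (hm : |z.re - m| < 1) : stripPeriodization f z = f (z - m) :=
  apply_sub_intCast_eq_of_periodic_on_strip hf ((abs_sub_round z.re).trans_lt one_half_lt_one) hm

variable [NormedAddCommGroup E] [NormedSpace ℂ E]

theorem differentiable_stripPeriodization
    (hf : ∀ z : ℂ, -1 < z.re → z.re < 0 → f (z + 1) = f z)
    (hd : ∀ z : ℂ, |z.re| < 1 → DifferentiableAt ℂ f z) :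
    Differentiable ℂ (stripPeriodization f) := by
  intro z
  have hz : |z.re - round z.re| < 1 := (abs_sub_round z.re).trans_lt one_half_lt_one
  have hloc : stripPeriodization f =ᶠ[𝓝 z] fun w => f (w - round z.re) := by
    have hopen : IsOpen {w : ℂ | |w.re - round z.re| < 1} := isOpen_lt (by fun_prop) (by fun_prop)
    filter_upwards [hopen.mem_nhds hz] with w hw using stripPeriodization_apply hf hw
  refine DifferentiableAt.congr_of_eventuallyEq ?_ hloc
  exact DifferentiableAt.comp z (g := f) (hd _ (by simpa using hz)) (by fun_prop)

theorem eq_of_periodic_of_bounded_on_strip {C : ℝ}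
    (hf : ∀ z : ℂ, -1 < z.re → z.re < 0 → f (z + 1) = f z)
    (hd : ∀ z : ℂ, |z.re| < 1 → DifferentiableAt ℂ f z)
    (hb : ∀ z : ℂ, |z.re| ≤ 1 / 2 → ‖f z‖ ≤ C) {z w : ℂ} (hz : |z.re| < 1) (hw : |w.re| < 1) :
    f z = f w := by
  have hrange : Bornology.IsBounded (Set.range (stripPeriodization f)) := by
    refine isBounded_iff_forall_norm_le.2 ⟨C, ?_⟩
    rintro _ ⟨z, rfl⟩
    exact hb _ (by simpa using abs_sub_round z.re)
  have happly {z : ℂ} (hz : |z.re| < 1) : stripPeriodization f z = f z := by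
    rw [stripPeriodization_apply hf (m := 0) (by rwa [Int.cast_zero, sub_zero]), Int.cast_zero,
      sub_zero]
  rw [← happly hz, ← happly hw]
  exact (differentiable_stripPeriodization hf hd).apply_eq_apply_of_bounded hrange z w

end strip

/-! ### Gourevich's series for `1 / π ^ 3` -/

/-- The ratio `(1/2)_m / (1)_m`, that is, `(2m choose m) / 4 ^ m`. -/
noncomputable def halfRatio (m : ℕ) : ℝ := pochhammerSymbol (1 / 2) m / m.factorial

theorem halfRatio_sq_mul (m : ℕ) : halfRatio m ^ 2 * (2 * m + 1) = (Real.Wallis.W m)⁻¹ := by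
  induction m with
  | zero => simp [halfRatio, pochhammerSymbol_zero, Real.Wallis.W]
  | succ m ih =>
    rw [Real.Wallis.W_succ, mul_inv, ← ih]
    unfold halfRatio
    rw [pochhammerSymbol_succ, Nat.factorial_succ]
    push_cast
    field_simp
    ring

theorem tendsto_halfRatio_sq_mul :
    Tendsto (fun m : ℕ => halfRatio m ^ 2 * (2 * m + 1)) atTop (𝓝 (2 / Real.pi)) := by
  simpa only [halfRatio_sq_mul, inv_div] using
    Real.Wallis.tendsto_W_nhds_pi_div_two.inv₀ (by positivity)

namespace Gourevich

/-- The hypergeometric part of the Wilf–Zeilberger pair that proves Gourevich's series for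
`1 / π ^ 3`. -/
noncomputable def weight (n k : ℕ) : ℝ :=
  pochhammerSymbol (1 / 2) (n + 2 * k) ^ 4 * pochhammerSymbol (1 / 2) n ^ 4 /
    ((n + k).factorial ^ 4 * (n + 2 * k).factorial * n.factorial *
      (2 * n + 2 * k + 1).factorial * 16 ^ (n + k))

/-- The polynomial part of `wzG`. -/
def polyG (n k : ℝ) : ℝ :=
  336 * n ^ 4 + 1344 * n ^ 3 * k + 320 * n ^ 3 + 1920 * n ^ 2 * k ^ 2 + 960 * n ^ 2 * k +
    104 * n ^ 2 + 1152 * n * k ^ 3 + 896 * n * k ^ 2 + 208 * n * k + 16 * n + 256 * k ^ 4 +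
    256 * k ^ 3 + 96 * k ^ 2 + 16 * k + 1

/-- The polynomial part of `wzF`. -/
def polyF (n k : ℝ) : ℝ :=
  336 * n ^ 4 + 1984 * n ^ 3 * k + 640 * n ^ 3 + 4352 * n ^ 2 * k ^ 2 + 2752 * n ^ 2 * k +
    392 * n ^ 2 + 4224 * n * k ^ 3 + 3968 * n * k ^ 2 + 1136 * n * k + 96 * n + 1536 * k ^ 4 +
    1920 * k ^ 3 + 832 * k ^ 2 + 144 * k + 9

/-- Gourevich's summand, deformed by a shift parameter `k`; its sum over `n` does not depend on
`k`. -/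
noncomputable def wzG (n k : ℕ) : ℝ := weight n k * polyG n k

/-- The Wilf–Zeilberger mate of `wzG`: the `k`-difference of `wzG` is the `n`-difference of
`wzF`. -/
noncomputable def wzF (n k : ℕ) : ℝ := weight n k * polyF n k * (n / (n + 2 * k + 1))

theorem weight_pos (n k : ℕ) : 0 < weight n k := by
  have := pochhammerSymbol_pos one_half_pos (n + 2 * k)
  have := pochhammerSymbol_pos one_half_pos n
  unfold weight
  positivity

theorem weight_succ_left (n k : ℕ) :
    weight (n + 1) k = weight n k * ((n + 2 * k + 1 / 2) ^ 4 * (n + 1 / 2) ^ 4 /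
      ((n + k + 1) ^ 4 * (n + 2 * k + 1) * (n + 1) * (2 * n + 2 * k + 2) *
        (2 * n + 2 * k + 3) * 16)) := by
  unfold weight
  rw [show n + 1 + 2 * k = n + 2 * k + 1 by ring, show n + 1 + k = n + k + 1 by ring,
    show 2 * (n + 1) + 2 * k + 1 = 2 * n + 2 * k + 1 + 1 + 1 by ring]
  simp only [pochhammerSymbol_succ, Nat.factorial_succ]
  push_cast
  field_simp
  ring

theorem weight_succ_right (n k : ℕ) :
    weight n (k + 1) = weight n k * ((n + 2 * k + 1 / 2) ^ 4 * (n + 2 * k + 3 / 2) ^ 4 /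
      ((n + k + 1) ^ 4 * (n + 2 * k + 1) * (n + 2 * k + 2) * (2 * n + 2 * k + 2) *
        (2 * n + 2 * k + 3) * 16)) := by
  unfold weight
  rw [show n + 2 * (k + 1) = n + 2 * k + 1 + 1 by ring, show n + (k + 1) = n + k + 1 by ring,
    show 2 * n + 2 * (k + 1) + 1 = 2 * n + 2 * k + 1 + 1 + 1 by ring]
  simp only [pochhammerSymbol_succ, Nat.factorial_succ]
  push_cast
  field_simp
  ring

theorem wz_equation (n k : ℕ) : wzG n (k + 1) - wzG n k = wzF (n + 1) k - wzF n k := by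
  unfold wzG wzF polyG polyF
  rw [weight_succ_left, weight_succ_right]
  push_cast
  rw [show (n : ℝ) + 1 + 2 * k + 1 = n + 2 * k + 2 by ring]
  field_simp
  ring

theorem weight_succ_left_le_mul (n k : ℕ) :
    weight (n + 1) k ≤ weight n k * ((n + 1) / (4 * (n + k + 1))) := by
  rw [weight_succ_left]
  refine mul_le_mul_of_nonneg_left ?_ (weight_pos n k).le
  rw [div_le_div_iff₀ (by positivity) (by positivity)]
  have := n.cast_nonneg (α := ℝ)
  have := k.cast_nonneg (α := ℝ)
  have h₁ : ((n : ℝ) + 2 * k + 1 / 2) ^ 4 ≤ (2 * (n + k + 1)) ^ 4 := by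
    gcongr
    linarith
  have h₂ : ((n : ℝ) + 1 / 2) ^ 4 ≤ (n + 2 * k + 1) * (n + 1) * (n + 1) * (n + k + 3 / 2) := by
    calc ((n : ℝ) + 1 / 2) ^ 4 = (n + 1 / 2) * (n + 1 / 2) * (n + 1 / 2) * (n + 1 / 2) := by ring
      _ ≤ _ := by gcongr <;> linarith
  calc _ ≤ (2 * ((n : ℝ) + k + 1)) ^ 4 *
        ((n + 2 * k + 1) * (n + 1) * (n + 1) * (n + k + 3 / 2)) * (4 * (n + k + 1)) := by gcongr
    _ = _ := by ring

theorem weight_le_mul_geometric (n k : ℕ) : weight n k ≤ weight 0 k * (1 / 4) ^ n := by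
  induction n with
  | zero => rw [pow_zero, mul_one]
  | succ n ih =>
    have hquarter : ((n : ℝ) + 1) / (4 * (n + k + 1)) ≤ 1 / 4 := by
      rw [div_le_div_iff₀ (by positivity) (by norm_num)]
      linarith [k.cast_nonneg (α := ℝ)]
    calc weight (n + 1) k ≤ weight n k * ((n + 1) / (4 * (n + k + 1))) :=
          weight_succ_left_le_mul n k
      _ ≤ weight 0 k * (1 / 4) ^ n * (1 / 4) :=
          mul_le_mul ih hquarter (by positivity) ((weight_pos n k).le.trans ih)
      _ = weight 0 k * (1 / 4) ^ (n + 1) := by ring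

section polynomials

variable {n k : ℝ}

theorem polyG_nonneg (hn : 0 ≤ n) (hk : 0 ≤ k) : 0 ≤ polyG n k := by unfold polyG; positivity

theorem polyF_nonneg (hn : 0 ≤ n) (hk : 0 ≤ k) : 0 ≤ polyF n k := by unfold polyF; positivity

theorem polyG_le (hn : 0 ≤ n) (hk : 0 ≤ k) : polyG n k ≤ 336 * (n + 1) ^ 4 * (k + 1) ^ 4 := by
  rw [← sub_nonneg]
  unfold polyG
  ring_nf
  positivity

theorem polyF_le (hn : 0 ≤ n) (hk : 0 ≤ k) : polyF n k ≤ 9 * polyG n k := by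
  rw [← sub_nonneg]
  unfold polyF polyG
  ring_nf
  positivity

theorem polyG_zero_left (k : ℝ) : polyG 0 k = (4 * k + 1) ^ 4 := by unfold polyG; ring

end polynomials

theorem wzG_nonneg (n k : ℕ) : 0 ≤ wzG n k :=
  mul_nonneg (weight_pos n k).le (polyG_nonneg n.cast_nonneg k.cast_nonneg)

theorem wzF_nonneg (n k : ℕ) : 0 ≤ wzF n k :=
  mul_nonneg (mul_nonneg (weight_pos n k).le (polyF_nonneg n.cast_nonneg k.cast_nonneg))
    (by positivity)

theorem wzF_zero_left (k : ℕ) : wzF 0 k = 0 := by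
  rw [wzF, Nat.cast_zero, zero_div, mul_zero]

theorem wzF_le (n k : ℕ) : wzF n k ≤ 9 * wzG n k := by
  have hn := n.cast_nonneg (α := ℝ)
  have hk := k.cast_nonneg (α := ℝ)
  have hratio : (n : ℝ) / (n + 2 * k + 1) ≤ 1 := by
    rw [div_le_one (by positivity)]
    linarith
  calc wzF n k ≤ weight n k * (9 * polyG n k) * 1 := by
        have := (weight_pos n k).le
        have := polyG_nonneg hn hk
        unfold wzF
        gcongr
        exact polyF_le hn hk
    _ = 9 * wzG n k := by rw [wzG]; ring

theorem wzG_zero_left (k : ℕ) :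
    wzG 0 k = (halfRatio (2 * k) ^ 2 * (2 * (2 * k : ℕ) + 1)) ^ 2 *
      (halfRatio k ^ 2 * (2 * k + 1)) * ((4 * k + 1) / (2 * k + 1)) ^ 2 := by
  have h16 : (16 : ℝ) ^ k = 4 ^ k * 4 ^ k := by rw [← mul_pow]; norm_num
  have := pochhammerSymbol_pos one_half_pos k
  unfold wzG weight halfRatio
  simp only [mul_zero, zero_add, Nat.factorial_succ, pochhammerSymbol_zero, Nat.factorial_zero,
    Nat.cast_zero, polyG_zero_left]
  push_cast
  rw [factorial_two_mul_eq_pochhammerSymbol_half, h16]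
  field_simp
  ring

theorem tendsto_wzG_zero_left : Tendsto (wzG 0) atTop (𝓝 (32 / Real.pi ^ 3)) := by
  have htwo : Tendsto (fun k : ℕ => 2 * k) atTop atTop :=
    tendsto_id.const_mul_atTop' two_pos
  have hratio : Tendsto (fun k : ℕ => (4 * (k : ℝ) + 1) / (2 * k + 1)) atTop (𝓝 2) := by
    have h : Tendsto (fun k : ℕ => 2 - 1 / (2 * (k : ℝ) + 1)) atTop (𝓝 (2 - 0)) :=
      tendsto_const_nhds.sub <| tendsto_const_nhds.div_atTop <|
        tendsto_atTop_add_const_right _ _ (tendsto_natCast_atTop_atTop.const_mul_atTop two_pos)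
    rw [sub_zero] at h
    refine h.congr fun k => ?_
    field_simp
    ring
  rw [show 32 / Real.pi ^ 3 = (2 / Real.pi) ^ 2 * (2 / Real.pi) * 2 ^ 2 by ring]
  exact ((((tendsto_halfRatio_sq_mul.comp htwo).pow 2).mul tendsto_halfRatio_sq_mul).mul
    (hratio.pow 2)).congr fun k => (wzG_zero_left k).symm

theorem exists_weight_mul_le :
    ∃ C : ℝ, ∀ n k : ℕ, weight n k * (k + 1) ^ 4 ≤ C * (1 / 4) ^ n := by
  obtain ⟨C, hC⟩ := tendsto_wzG_zero_left.bddAbove_range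
  have hzero (k : ℕ) : weight 0 k * (k + 1) ^ 4 ≤ C := by
    calc weight 0 k * (k + 1) ^ 4 ≤ weight 0 k * (4 * k + 1) ^ 4 := by
          have := (weight_pos 0 k).le
          gcongr
          linarith [k.cast_nonneg (α := ℝ)]
      _ = wzG 0 k := by rw [wzG, Nat.cast_zero, polyG_zero_left]
      _ ≤ C := hC ⟨k, rfl⟩
  refine ⟨C, fun n k => ?_⟩
  calc weight n k * (k + 1) ^ 4 ≤ weight 0 k * (1 / 4) ^ n * (k + 1) ^ 4 := by
        gcongr
        exact weight_le_mul_geometric n k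
    _ = weight 0 k * (k + 1) ^ 4 * (1 / 4) ^ n := by ring
    _ ≤ C * (1 / 4) ^ n := by
        gcongr
        exact hzero k

theorem exists_wzG_le :
    ∃ C : ℝ, ∀ n k : ℕ, wzG n k ≤ C * (((n : ℝ) + 1) ^ 4 * (1 / 4) ^ n) := by
  obtain ⟨C, hC⟩ := exists_weight_mul_le
  refine ⟨336 * C, fun n k => ?_⟩
  calc wzG n k ≤ weight n k * (336 * (n + 1) ^ 4 * (k + 1) ^ 4) :=
        mul_le_mul_of_nonneg_left (polyG_le n.cast_nonneg k.cast_nonneg) (weight_pos n k).le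
    _ = 336 * (n + 1) ^ 4 * (weight n k * (k + 1) ^ 4) := by ring
    _ ≤ 336 * (n + 1) ^ 4 * (C * (1 / 4) ^ n) :=
        mul_le_mul_of_nonneg_left (hC n k) (by positivity)
    _ = 336 * C * (((n : ℝ) + 1) ^ 4 * (1 / 4) ^ n) := by ring

theorem tendsto_wzG_succ_left (n : ℕ) : Tendsto (wzG (n + 1)) atTop (𝓝 0) := by
  obtain ⟨C, hC⟩ := exists_weight_mul_le
  set A : ℝ := (n + 1) / 4 * (336 * ((n + 1 : ℕ) + 1) ^ 4) * (C * (1 / 4) ^ n)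
  have hle (k : ℕ) : wzG (n + 1) k ≤ A * (1 / (k + 1)) := by
    have := n.cast_nonneg (α := ℝ)
    have hratio : ((n : ℝ) + 1) / (4 * (n + k + 1)) ≤ (n + 1) / 4 * (1 / (k + 1)) := by
      rw [div_mul_div_comm, mul_one]
      gcongr
      linarith
    calc wzG (n + 1) k
        ≤ weight n k * ((n + 1) / 4 * (1 / (k + 1))) *
            (336 * ((n + 1 : ℕ) + 1) ^ 4 * (k + 1) ^ 4) := by
          have := (weight_pos n k).le
          exact mul_le_mul ((weight_succ_left_le_mul n k).trans (by gcongr))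
            (polyG_le (Nat.cast_nonneg _) k.cast_nonneg)
            (polyG_nonneg (Nat.cast_nonneg _) k.cast_nonneg) (by positivity)
      _ = (n + 1) / 4 * (336 * ((n + 1 : ℕ) + 1) ^ 4) * (weight n k * (k + 1) ^ 4) *
            (1 / (k + 1)) := by ring
      _ ≤ A * (1 / (k + 1)) :=
          mul_le_mul_of_nonneg_right (mul_le_mul_of_nonneg_left (hC n k) (by positivity))
            (by positivity)
  refine squeeze_zero (wzG_nonneg _) hle ?_
  simpa only [mul_zero] using tendsto_one_div_add_atTop_nhds_zero_nat.const_mul A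

theorem tendsto_wzF (k : ℕ) : Tendsto (wzF · k) atTop (𝓝 0) := by
  obtain ⟨C, hC⟩ := exists_wzG_le
  have hG : Summable (wzG · k) :=
    .of_nonneg_of_le (wzG_nonneg · k) (hC · k)
      ((summable_natCast_add_one_pow_mul_geometric 4 (by norm_num)).mul_left C)
  refine squeeze_zero (wzF_nonneg · k) (wzF_le · k) ?_
  simpa only [mul_zero] using hG.tendsto_atTop_zero.const_mul 9

theorem hasSum_wzG_zero : HasSum (wzG · 0) (32 / Real.pi ^ 3) := by
  obtain ⟨C, hC⟩ := exists_wzG_le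
  have hlim (n : ℕ) : Tendsto (wzG n) atTop
      (𝓝 ((Pi.single 0 (32 / Real.pi ^ 3) : ℕ → ℝ) n)) := by
    cases n with
    | zero => simpa only [Pi.single_eq_same] using tendsto_wzG_zero_left
    | succ n => simpa only [Pi.single_eq_of_ne n.succ_ne_zero] using tendsto_wzG_succ_left n
  have h := hasSum_tsum_limit_of_wz_equation wz_equation wzF_zero_left tendsto_wzF
    ((summable_natCast_add_one_pow_mul_geometric 4 (r := (1 / 4 : ℝ)) (by norm_num)).mul_left C)
    (fun n k => by rw [Real.norm_of_nonneg (wzG_nonneg n k)]; exact hC n k) hlim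
  rwa [tsum_pi_single] at h

theorem wzG_zero_right (n : ℕ) :
    wzG n 0 = pochhammerSymbol (1 / 2) n ^ 7 / pochhammerSymbol 1 n ^ 7 * (1 / 2 ^ (6 * n)) *
      (168 * (n : ℝ) ^ 3 + 76 * (n : ℝ) ^ 2 + 14 * (n : ℝ) + 1) := by
  have h64 : (2 : ℝ) ^ (6 * n) = 16 ^ n * 4 ^ n := by rw [pow_mul, ← mul_pow]; norm_num
  have := pochhammerSymbol_pos one_half_pos n
  unfold wzG weight polyG
  simp only [mul_zero, add_zero, Nat.factorial_succ, pochhammerSymbol_one, h64]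
  push_cast
  rw [factorial_two_mul_eq_pochhammerSymbol_half]
  field_simp
  ring

end Gourevich

/-! ### Guillera's series for `π ^ 4` -/

namespace Guillera

/-- The part of the summand that depends on the deformation parameter `x`. Up to a factor depending
only on `n` it is a product of Pochhammer symbols; the Gamma factors make the deformed sum exactly,
rather than only up to a rational function, periodic in `x`. -/
noncomputable def gammaRatio (n : ℕ) (x : ℂ) : ℂ :=
  Complex.Gamma (1 + x) * Complex.Gamma (1 - x) *
    ((ascPochhammer ℂ n).eval (1 + 2 * x) * (ascPochhammer ℂ n).eval (1 - 2 * x)) *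
    ((Complex.Gamma (n + 3 / 2 + x))⁻¹ * (Complex.Gamma (n + 3 / 2 - x))⁻¹)

/-- The ratio `(1)_n / (3/2)_n`. -/
noncomputable def factorialRatio (n : ℕ) : ℝ := n.factorial / pochhammerSymbol (3 / 2) n

/-- The hypergeometric part of the Wilf–Zeilberger pair that proves Guillera's series for
`π ^ 4`. -/
noncomputable def weight (n : ℕ) (x : ℂ) : ℂ :=
  gammaRatio n x ^ 2 * factorialRatio n ^ 3 / 64 ^ n

/-- The polynomial part of `wzG`. -/
def polyG (n x : ℂ) : ℂ := (3 * n + 2) * (7 * n ^ 2 + 9 * n + 3 - 4 * x ^ 2)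

/-- The rational part of `wzF`. -/
noncomputable def ratioF (n x : ℂ) : ℂ :=
  128 * (2 * x + 1) * n * (n + 1 / 2) ^ 3 * (n + 1 / 2 - x) ^ 2 /
    ((n - 1 - 2 * x) ^ 2 * (n - 2 * x) ^ 2)

/-- The summand of the series for `π ^ 4`, with index shifted to start at `0` and deformed by a
complex parameter `x`. -/
noncomputable def wzG (n : ℕ) (x : ℂ) : ℂ := weight n x * polyG n x

/-- The Wilf–Zeilberger mate of `wzG`: the `x`-difference of `wzG` is the `n`-difference of
`wzF`. -/
noncomputable def wzF (n : ℕ) (x : ℂ) : ℂ := -(weight n x * ratioF n x)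

theorem gammaRatio_neg (n : ℕ) (x : ℂ) : gammaRatio n (-x) = gammaRatio n x := by
  simp only [gammaRatio, mul_neg, ← sub_eq_add_neg, sub_neg_eq_add]
  ring

theorem wzG_neg (n : ℕ) (x : ℂ) : wzG n (-x) = wzG n x := by
  simp only [wzG, weight, polyG, gammaRatio_neg, neg_sq]

theorem gammaRatio_succ (n : ℕ) (x : ℂ) :
    gammaRatio (n + 1) x * ((n + 3 / 2) ^ 2 - x ^ 2) =
      gammaRatio n x * ((n + 1) ^ 2 - 4 * x ^ 2) := by
  have hplus := Complex.one_div_Gamma_eq_self_mul_one_div_Gamma_add_one (n + 3 / 2 + x)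
  have hminus := Complex.one_div_Gamma_eq_self_mul_one_div_Gamma_add_one (n + 3 / 2 - x)
  unfold gammaRatio
  rw [hplus, hminus, ascPochhammer_succ_eval, ascPochhammer_succ_eval]
  push_cast
  rw [show (n : ℂ) + 1 + 3 / 2 + x = n + 3 / 2 + x + 1 by ring,
    show (n : ℂ) + 1 + 3 / 2 - x = n + 3 / 2 - x + 1 by ring]
  ring

theorem factorialRatio_succ (n : ℕ) :
    factorialRatio (n + 1) * (n + 3 / 2) = factorialRatio n * (n + 1) := by
  have := pochhammerSymbol_pos (by norm_num : (0 : ℝ) < 3 / 2) n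
  unfold factorialRatio
  rw [pochhammerSymbol_succ, Nat.factorial_succ, add_comm (3 / 2 : ℝ)]
  push_cast
  field_simp

theorem weight_succ (n : ℕ) (x : ℂ) :
    weight (n + 1) x * (64 * (n + 3 / 2) ^ 3 * ((n + 3 / 2) ^ 2 - x ^ 2) ^ 2) =
      weight n x * ((n + 1) ^ 3 * ((n + 1) ^ 2 - 4 * x ^ 2) ^ 2) := by
  have hratio : (factorialRatio (n + 1) : ℂ) * (n + 3 / 2) = factorialRatio n * (n + 1) := by
    have h := congrArg Complex.ofReal (factorialRatio_succ n)
    push_cast at h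
    exact h
  unfold weight
  calc _ = (gammaRatio (n + 1) x * ((n + 3 / 2) ^ 2 - x ^ 2)) ^ 2 *
        (factorialRatio (n + 1) * (n + 3 / 2)) ^ 3 / 64 ^ n := by ring
    _ = _ := by rw [gammaRatio_succ, hratio]; ring

theorem gammaRatio_add_one (n : ℕ) {x : ℂ} (hx : x ≠ 0) (hx' : 1 + x ≠ 0) :
    gammaRatio n (x + 1) * ((n - 1 - 2 * x) * (n - 2 * x) * (n + 3 / 2 + x)) =
      -(gammaRatio n x * ((n + 1 + 2 * x) * (n + 2 + 2 * x) * (n + 1 / 2 - x))) := by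
  have hplus := mul_ascPochhammer_eval_add_two n (1 + 2 * x)
  have hminus := mul_ascPochhammer_eval_add_two n (1 - 2 * (x + 1))
  rw [show 1 + 2 * x + 2 = 1 + 2 * (x + 1) by ring] at hplus
  rw [show 1 - 2 * (x + 1) + 2 = 1 - 2 * x by ring] at hminus
  have hΓ₁ := Complex.Gamma_add_one _ hx'
  have hΓ₂ := Complex.Gamma_add_one _ (neg_ne_zero.2 hx)
  have hΓ₃ := Complex.one_div_Gamma_eq_self_mul_one_div_Gamma_add_one (n + 3 / 2 + x)
  have hΓ₄ := Complex.one_div_Gamma_eq_self_mul_one_div_Gamma_add_one (n + 1 / 2 - x)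
  rw [show 1 + x + 1 = 1 + (x + 1) by ring] at hΓ₁
  rw [show -x + 1 = 1 - x by ring, show -x = 1 - (x + 1) by ring] at hΓ₂
  rw [show n + 3 / 2 + x + 1 = n + 3 / 2 + (x + 1) by ring] at hΓ₃
  rw [show n + 1 / 2 - x + 1 = n + 3 / 2 - x by ring,
    show n + 1 / 2 - x = n + 3 / 2 - (x + 1) by ring] at hΓ₄
  unfold gammaRatio
  rw [hΓ₁, hΓ₂, hΓ₃, hΓ₄]
  linear_combination Complex.Gamma (1 + x) * Complex.Gamma (1 - (x + 1)) *
    (Complex.Gamma (n + 3 / 2 + (x + 1)))⁻¹ * (Complex.Gamma (n + 3 / 2 - x))⁻¹ *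
    ((n + 3 / 2 + x) * (n + 1 / 2 - x)) *
    (x * (ascPochhammer ℂ n).eval (1 - 2 * x) * hplus -
      (1 + x) * (ascPochhammer ℂ n).eval (1 + 2 * (x + 1)) * hminus)

theorem weight_add_one (n : ℕ) {x : ℂ} (hx : x ≠ 0) (hx' : 1 + x ≠ 0) :
    weight n (x + 1) * ((n - 1 - 2 * x) * (n - 2 * x) * (n + 3 / 2 + x)) ^ 2 =
      weight n x * ((n + 1 + 2 * x) * (n + 2 + 2 * x) * (n + 1 / 2 - x)) ^ 2 := by
  unfold weight
  linear_combination (gammaRatio n (x + 1) *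
    ((n - 1 - 2 * x) * (n - 2 * x) * (n + 3 / 2 + x)) - gammaRatio n x *
    ((n + 1 + 2 * x) * (n + 2 + 2 * x) * (n + 1 / 2 - x))) * (factorialRatio n ^ 3 / 64 ^ n) *
    gammaRatio_add_one n hx hx'

theorem wzF_mul {n : ℕ} {x : ℂ} (h₁ : (n : ℂ) - 1 - 2 * x ≠ 0) (h₂ : (n : ℂ) - 2 * x ≠ 0) :
    wzF n x * ((n - 1 - 2 * x) * (n - 2 * x)) ^ 2 =
      -(weight n x * (128 * (2 * x + 1) * n * (n + 1 / 2) ^ 3 * (n + 1 / 2 - x) ^ 2)) := by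
  unfold wzF ratioF
  field_simp

theorem wzF_succ_mul {n : ℕ} {x : ℂ} (h₁ : (n : ℂ) - 2 * x ≠ 0) (h₂ : (n : ℂ) + 1 - 2 * x ≠ 0) :
    wzF (n + 1) x * ((n - 2 * x) * (n + 3 / 2 + x)) ^ 2 =
      -(weight n x * (2 * (2 * x + 1) * (n + 1) ^ 4 * (n + 1 + 2 * x) ^ 2)) := by
  have hF := wzF_mul (n := n + 1) (x := x) (by push_cast; rwa [add_sub_cancel_right])
    (by push_cast; exact h₂)
  push_cast at hF
  refine mul_right_cancel₀ (pow_ne_zero 2 h₂) ?_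
  linear_combination (n + 3 / 2 + x) ^ 2 * hF - 2 * (2 * x + 1) * (n + 1) * weight_succ n x

theorem natCast_sub_two_mul_ne_zero (n : ℕ) {x : ℂ} (h : x.re < 0) : (n : ℂ) - 2 * x ≠ 0 := by
  refine ne_zero_of_re_pos ?_
  simp only [Complex.sub_re, Complex.natCast_re, Complex.mul_re, Complex.re_ofNat,
    Complex.im_ofNat, zero_mul, sub_zero]
  linarith [n.cast_nonneg (α := ℝ)]

theorem natCast_sub_one_sub_two_mul_ne_zero (n : ℕ) {x : ℂ} (h : x.re < 0)
    (hx : 2 * x + 1 ≠ 0) : (n : ℂ) - 1 - 2 * x ≠ 0 := by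
  rcases n with _ | n
  · contrapose! hx
    push_cast at hx
    linear_combination -hx
  · push_cast
    rw [add_sub_cancel_right]
    exact natCast_sub_two_mul_ne_zero n h

theorem wz_equation (n : ℕ) {x : ℂ} (h₁ : -1 < x.re) (h₂ : x.re < 0) :
    wzG n (x + 1) - wzG n x = wzF (n + 1) x - wzF n x := by
  -- At `x = -1 / 2` the denominator of `wzF 0 x` vanishes, but there both sides are zero.
  by_cases hx : 2 * x + 1 = 0
  · obtain rfl : x = -(1 / 2) := by linear_combination hx / 2
    simp only [wzF, ratioF, hx, mul_zero, zero_mul, zero_div, neg_zero, sub_self]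
    rw [wzG_neg, show -(1 / 2 : ℂ) + 1 = 1 / 2 by norm_num, sub_self]
  have := n.cast_nonneg (α := ℝ)
  have ha := natCast_sub_one_sub_two_mul_ne_zero n h₂ hx
  have hb : (n : ℂ) - 2 * x ≠ 0 := natCast_sub_two_mul_ne_zero n h₂
  have hc : (n : ℂ) + 3 / 2 + x ≠ 0 := ne_zero_of_re_pos (by
    simp only [Complex.add_re, Complex.natCast_re, Complex.div_ofNat_re, Complex.re_ofNat]
    linarith)
  have hb' : (n : ℂ) + 1 - 2 * x ≠ 0 := by exact_mod_cast natCast_sub_two_mul_ne_zero (n + 1) h₂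
  have hx₀ : x ≠ 0 := by rintro rfl; exact h₂.ne rfl
  have hx₁ : 1 + x ≠ 0 := ne_zero_of_re_pos (by rw [Complex.add_re, Complex.one_re]; linarith)
  refine mul_right_cancel₀ (pow_ne_zero 2 (mul_ne_zero (mul_ne_zero ha hb) hc)) ?_
  unfold wzG polyG
  linear_combination
    (3 * n + 2) * (7 * n ^ 2 + 9 * n + 3 - 4 * (x + 1) ^ 2) * weight_add_one n hx₀ hx₁ -
      (n - 1 - 2 * x) ^ 2 * wzF_succ_mul hb hb' + (n + 3 / 2 + x) ^ 2 * wzF_mul ha hb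

theorem norm_weight_succ_le (n : ℕ) {x : ℂ} (hx : |x.re| ≤ 1) :
    ‖weight (n + 1) x‖ ≤ ‖weight n x‖ * (1 / 4) := by
  set N : ℂ := (n + 1) ^ 2 - 4 * x ^ 2
  set D : ℂ := (n + 3 / 2) ^ 2 - x ^ 2
  have := n.cast_nonneg (α := ℝ)
  have hD : D ≠ 0 := by
    have h := ofReal_sq_sub_sq_ne_zero (z := x) (s := n + 3 / 2) (by linarith)
    push_cast at h
    exact h
  have hN : ‖N‖ ≤ 4 * ‖D‖ := by
    have h := norm_ofReal_sq_sub_sq_le_norm_ofReal_sq_sub_sq (z := x) (s := (n + 1) / 2)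
      (t := n + 3 / 2) (by linarith) (by linarith)
    push_cast at h
    calc ‖N‖ = ‖4 * (((n + 1) / 2) ^ 2 - x ^ 2)‖ := by congr 1; ring
      _ = 4 * ‖((n + 1) / 2) ^ 2 - x ^ 2‖ := by rw [norm_mul, Complex.norm_ofNat]
      _ ≤ 4 * ‖D‖ := by gcongr
  have hrel : ‖weight (n + 1) x‖ * (64 * ((n : ℝ) + 3 / 2) ^ 3 * ‖D‖ ^ 2) =
      ‖weight n x‖ * (((n : ℝ) + 1) ^ 3 * ‖N‖ ^ 2) := by
    have h₁ : ‖(n + 1 : ℂ)‖ = n + 1 := by exact_mod_cast Complex.norm_natCast (n + 1)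
    have h₃ : ‖(n + 3 / 2 : ℂ)‖ = n + 3 / 2 := by
      have h := Complex.norm_of_nonneg (r := n + 3 / 2) (by positivity)
      push_cast at h
      exact h
    simpa only [norm_mul, norm_pow, Complex.norm_ofNat, h₁, h₃] using
      congrArg norm (weight_succ n x)
  have hpos : 0 < 64 * ((n : ℝ) + 3 / 2) ^ 3 * ‖D‖ ^ 2 := by positivity
  refine le_of_mul_le_mul_right ?_ hpos
  calc ‖weight (n + 1) x‖ * (64 * ((n : ℝ) + 3 / 2) ^ 3 * ‖D‖ ^ 2)
      = ‖weight n x‖ * (((n : ℝ) + 1) ^ 3 * ‖N‖ ^ 2) := hrel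
    _ ≤ ‖weight n x‖ * (((n : ℝ) + 3 / 2) ^ 3 * (4 * ‖D‖) ^ 2) := by gcongr; norm_num
    _ = ‖weight n x‖ * (1 / 4) * (64 * ((n : ℝ) + 3 / 2) ^ 3 * ‖D‖ ^ 2) := by ring

theorem norm_weight_le (n : ℕ) {x : ℂ} (hx : |x.re| ≤ 1) :
    ‖weight n x‖ ≤ ‖weight 0 x‖ * (1 / 4) ^ n := by
  induction n with
  | zero => rw [pow_zero, mul_one]
  | succ n ih =>
    calc ‖weight (n + 1) x‖ ≤ ‖weight n x‖ * (1 / 4) := norm_weight_succ_le n hx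
      _ ≤ ‖weight 0 x‖ * (1 / 4) ^ n * (1 / 4) := by gcongr
      _ = ‖weight 0 x‖ * (1 / 4) ^ (n + 1) := by ring

theorem norm_polyG_le (n : ℕ) (x : ℂ) :
    ‖polyG n x‖ ≤ 27 * (1 + ‖x‖ ^ 2) * ((n : ℝ) + 1) ^ 3 := by
  have hn := n.cast_nonneg (α := ℝ)
  have hlin : ‖(3 * n + 2 : ℂ)‖ ≤ 3 * ((n : ℝ) + 1) := by
    refine (norm_add_le _ _).trans ?_
    rw [norm_mul, Complex.norm_ofNat, Complex.norm_ofNat, Complex.norm_natCast]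
    linarith
  have hreal : ‖(7 * n ^ 2 + 9 * n + 3 : ℂ)‖ = 7 * (n : ℝ) ^ 2 + 9 * n + 3 := by
    exact_mod_cast Complex.norm_natCast (7 * n ^ 2 + 9 * n + 3)
  have hquad : ‖(7 * n ^ 2 + 9 * n + 3 - 4 * x ^ 2 : ℂ)‖ ≤
      9 * (1 + ‖x‖ ^ 2) * ((n : ℝ) + 1) ^ 2 := by
    refine (norm_sub_le _ _).trans ?_
    rw [hreal, norm_mul, norm_pow, Complex.norm_ofNat]
    nlinarith [mul_nonneg hn (sq_nonneg ‖x‖), mul_nonneg (sq_nonneg (n : ℝ)) (sq_nonneg ‖x‖),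
      sq_nonneg ‖x‖]
  calc ‖polyG n x‖ ≤ 3 * ((n : ℝ) + 1) * (9 * (1 + ‖x‖ ^ 2) * ((n : ℝ) + 1) ^ 2) := by
        rw [polyG, norm_mul]
        gcongr
    _ = 27 * (1 + ‖x‖ ^ 2) * ((n : ℝ) + 1) ^ 3 := by ring

theorem norm_wzG_le (n : ℕ) {x : ℂ} (hx : |x.re| ≤ 1) :
    ‖wzG n x‖ ≤ 27 * (‖weight 0 x‖ * (1 + ‖x‖ ^ 2)) * (((n : ℝ) + 1) ^ 3 * (1 / 4) ^ n) := by
  calc ‖wzG n x‖ ≤ ‖weight 0 x‖ * (1 / 4) ^ n * (27 * (1 + ‖x‖ ^ 2) * ((n : ℝ) + 1) ^ 3) := by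
        rw [wzG, norm_mul]
        gcongr
        · exact norm_weight_le n hx
        · exact norm_polyG_le n x
    _ = _ := by ring

theorem summable_geometric_bound (p : ℕ) :
    Summable fun n : ℕ => ((n : ℝ) + 1) ^ p * (1 / 4) ^ n :=
  summable_natCast_add_one_pow_mul_geometric p (by norm_num)

theorem summable_wzG {x : ℂ} (hx : |x.re| ≤ 1) : Summable fun n => wzG n x :=
  .of_norm_bounded ((summable_geometric_bound 3).mul_left _) fun n => norm_wzG_le n hx

theorem wzF_zero_left (x : ℂ) : wzF 0 x = 0 := by
  simp only [wzF, ratioF, Nat.cast_zero, mul_zero, zero_mul, zero_div, neg_zero]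

theorem norm_ratioF_le {n : ℕ} (hn : 1 ≤ n) {x : ℂ} (hx : x.re < 0) :
    ‖ratioF n x‖ ≤ 128 * ‖2 * x + 1‖ * (1 + ‖x‖) ^ 2 / (2 * x.re) ^ 4 * ((n : ℝ) + 1) ^ 6 := by
  have : (1 : ℝ) ≤ n := by exact_mod_cast hn
  have hpos : 0 < -(2 * x.re) := by linarith
  have hd₁ : -(2 * x.re) ≤ ‖(n - 1 - 2 * x : ℂ)‖ := by
    refine le_trans ?_ (Complex.re_le_norm _)
    simp only [Complex.sub_re, Complex.natCast_re, Complex.one_re, Complex.mul_re,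
      Complex.re_ofNat, Complex.im_ofNat, zero_mul, sub_zero]
    linarith
  have hd₂ : -(2 * x.re) ≤ ‖(n - 2 * x : ℂ)‖ := by
    refine le_trans ?_ (Complex.re_le_norm _)
    simp
  have hhalf : ‖(n + 1 / 2 : ℂ)‖ ≤ n + 1 := (norm_add_le _ _).trans (by norm_num)
  have hsub : ‖(n + 1 / 2 - x : ℂ)‖ ≤ (1 + ‖x‖) * (n + 1) := by
    refine (norm_sub_le _ _).trans ?_
    nlinarith [norm_nonneg x]
  have hn₁ : ‖(n : ℂ)‖ ≤ n + 1 := by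
    rw [Complex.norm_natCast]
    linarith
  calc ‖ratioF n x‖ ≤ 128 * ‖2 * x + 1‖ * ((n : ℝ) + 1) * ((n : ℝ) + 1) ^ 3 *
        ((1 + ‖x‖) * ((n : ℝ) + 1)) ^ 2 / ((-(2 * x.re)) ^ 2 * (-(2 * x.re)) ^ 2) := by
        rw [ratioF]
        simp only [norm_div, norm_mul, norm_pow, Complex.norm_ofNat]
        gcongr
    _ = _ := by ring

theorem tendsto_wzF {x : ℂ} (h₁ : -1 < x.re) (h₂ : x.re < 0) :
    Tendsto (fun n => wzF n x) atTop (𝓝 0) := by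
  have hx : |x.re| ≤ 1 := abs_le.2 ⟨h₁.le, by linarith⟩
  set A : ℝ := 128 * ‖2 * x + 1‖ * (1 + ‖x‖) ^ 2 / (2 * x.re) ^ 4
  have hlim := (summable_geometric_bound 6).tendsto_atTop_zero.const_mul (‖weight 0 x‖ * A)
  rw [mul_zero] at hlim
  refine squeeze_zero_norm' ?_ hlim
  filter_upwards [eventually_ge_atTop 1] with n hn
  calc ‖wzF n x‖ ≤ ‖weight 0 x‖ * (1 / 4) ^ n * (A * ((n : ℝ) + 1) ^ 6) := by
        rw [wzF, norm_neg, norm_mul]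
        gcongr
        · exact norm_weight_le n hx
        · exact norm_ratioF_le hn h₂
    _ = ‖weight 0 x‖ * A * (((n : ℝ) + 1) ^ 6 * (1 / 4) ^ n) := by ring

/-- The sum over `n` of the deformed summand `wzG n x`. -/
noncomputable def deformedSum (x : ℂ) : ℂ := ∑' n, wzG n x

theorem deformedSum_add_one {x : ℂ} (h₁ : -1 < x.re) (h₂ : x.re < 0) :
    deformedSum (x + 1) = deformedSum x := by
  have hx : |x.re| ≤ 1 := abs_le.2 ⟨h₁.le, by linarith⟩
  have hx' : |(x + 1).re| ≤ 1 := by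
    rw [Complex.add_re, Complex.one_re, abs_le]
    constructor <;> linarith
  exact tsum_eq_tsum_of_sub_eq_telescoping (summable_wzG hx') (summable_wzG hx)
    (fun n => wz_equation n h₁ h₂) (wzF_zero_left x) (tendsto_wzF h₁ h₂)

theorem differentiableAt_weight (n : ℕ) {x : ℂ} (hx : |x.re| < 1) :
    DifferentiableAt ℂ (weight n) x := by
  obtain ⟨hx₁, hx₂⟩ := abs_lt.1 hx
  have hΓ₁ : DifferentiableAt ℂ (fun x => Complex.Gamma (1 + x)) x :=
    DifferentiableAt.comp x (g := Complex.Gamma)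
      (differentiableAt_Gamma_of_re_pos (by rw [Complex.add_re, Complex.one_re]; linarith))
      (by fun_prop)
  have hΓ₂ : DifferentiableAt ℂ (fun x => Complex.Gamma (1 - x)) x :=
    DifferentiableAt.comp x (g := Complex.Gamma)
      (differentiableAt_Gamma_of_re_pos (by rw [Complex.sub_re, Complex.one_re]; linarith))
      (by fun_prop)
  have hΓ₃ : Differentiable ℂ fun x => (Complex.Gamma (n + 3 / 2 + x))⁻¹ :=
    Complex.differentiable_one_div_Gamma.comp (by fun_prop)
  have hΓ₄ : Differentiable ℂ fun x => (Complex.Gamma (n + 3 / 2 - x))⁻¹ :=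
    Complex.differentiable_one_div_Gamma.comp (by fun_prop)
  unfold weight gammaRatio
  fun_prop

theorem differentiableAt_deformedSum {x : ℂ} (hx : |x.re| < 1) :
    DifferentiableAt ℂ deformedSum x := by
  have hcont : ContinuousAt (fun z => ‖weight 0 z‖ * (1 + ‖z‖ ^ 2)) x :=
    (differentiableAt_weight 0 hx).continuousAt.norm.mul (by fun_prop)
  have hstrip : ∀ᶠ z : ℂ in 𝓝 x, |z.re| < 1 :=
    (isOpen_lt (by fun_prop) (by fun_prop)).mem_nhds hx
  obtain ⟨U, hU, hopen, hxU⟩ := mem_nhds_iff.1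
    (hstrip.and (hcont.eventually_lt_const (lt_add_one (‖weight 0 x‖ * (1 + ‖x‖ ^ 2)))))
  have hdiff (n : ℕ) : DifferentiableOn ℂ (wzG n) U := fun z hz =>
    ((differentiableAt_weight n (hU hz).1).mul
      (by unfold polyG; fun_prop)).differentiableWithinAt
  refine (Complex.differentiableOn_tsum_of_summable_norm
    ((summable_geometric_bound 3).mul_left (27 * (‖weight 0 x‖ * (1 + ‖x‖ ^ 2) + 1)))
    hdiff hopen fun n z hz => ?_).differentiableAt (hopen.mem_nhds hxU)
  obtain ⟨hz, hlt⟩ := hU hz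
  refine (norm_wzG_le n hz.le).trans ?_
  gcongr

theorem factorialRatio_zero : factorialRatio 0 = 1 := by
  rw [factorialRatio, Nat.factorial_zero, pochhammerSymbol_zero, Nat.cast_one, div_one]

theorem weight_zero_left (x : ℂ) : weight 0 x = gammaRatio 0 x ^ 2 := by
  rw [weight, factorialRatio_zero, Complex.ofReal_one, one_pow, mul_one, pow_zero, div_one]

theorem gammaRatio_zero_left (x : ℂ) :
    gammaRatio 0 x = Complex.Gamma (1 + x) * Complex.Gamma (1 - x) *
      ((Complex.Gamma (3 / 2 + x))⁻¹ * (Complex.Gamma (3 / 2 - x))⁻¹) := by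
  simp only [gammaRatio, ascPochhammer_zero, Polynomial.eval_one, mul_one, Nat.cast_zero, zero_add]

theorem gammaRatio_zero_left_eq_cos_div_sin {x : ℂ} (hx : x ≠ 0) (h₁ : 1 / 2 + x ≠ 0)
    (h₂ : 1 / 2 - x ≠ 0) :
    gammaRatio 0 x = x * Complex.cos (Real.pi * x) /
      (Complex.sin (Real.pi * x) * ((1 / 2 + x) * (1 / 2 - x))) := by
  have hsin := Complex.Gamma_mul_Gamma_one_sub x
  have hcos := Complex.Gamma_mul_Gamma_one_sub (1 / 2 + x)
  rw [show 1 - (1 / 2 + x) = 1 / 2 - x by ring,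
    show (Real.pi : ℂ) * (1 / 2 + x) = Real.pi * x + Real.pi / 2 by ring,
    Complex.sin_add_pi_div_two] at hcos
  have hpi : (Real.pi : ℂ) ≠ 0 := by exact_mod_cast Real.pi_ne_zero
  rw [gammaRatio_zero_left, add_comm 1 x, show 3 / 2 + x = 1 / 2 + x + 1 by ring,
    show 3 / 2 - x = 1 / 2 - x + 1 by ring, Complex.Gamma_add_one _ hx,
    Complex.Gamma_add_one _ h₁, Complex.Gamma_add_one _ h₂]
  calc _ = x * (Complex.Gamma x * Complex.Gamma (1 - x)) * ((1 / 2 + x) * (1 / 2 - x))⁻¹ *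
        (Complex.Gamma (1 / 2 + x) * Complex.Gamma (1 / 2 - x))⁻¹ := by
        simp only [mul_inv]
        ring
    _ = _ := by
        rw [hsin, hcos, inv_div]
        field_simp

theorem norm_gammaRatio_zero_left_sq_mul_le {x : ℂ} (hx : 1 ≤ |x.im|) :
    ‖gammaRatio 0 x‖ ^ 2 * (1 + ‖x‖ ^ 2) ≤ 8 := by
  have hx₁ : 1 ≤ ‖x‖ := hx.trans (Complex.abs_im_le_norm x)
  have him : x.im ≠ 0 := abs_pos.1 (one_pos.trans_le hx)
  have h₀ : x ≠ 0 := by rintro rfl; exact him rfl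
  have h₁ : 1 / 2 + x ≠ 0 := fun h => him (by simpa using congrArg Complex.im h)
  have h₂ : 1 / 2 - x ≠ 0 := fun h => him (by simpa using congrArg Complex.im h)
  set S := ‖Complex.sin (Real.pi * x)‖
  set Q := ‖(1 / 2 + x) * (1 / 2 - x)‖
  have hS : 1 ≤ S := one_le_norm_sin_pi_mul hx
  have hcos : ‖Complex.cos (Real.pi * x)‖ ^ 2 ≤ 2 * S ^ 2 :=
    (norm_cos_sq_le _).trans (by nlinarith)
  have hQ : 3 / 4 * ‖x‖ ^ 2 ≤ Q := by
    have h : ‖x‖ ^ 2 - 1 / 4 ≤ Q := by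
      rw [← norm_pow, ← norm_neg (x ^ 2)]
      calc _ = ‖-x ^ 2‖ - ‖(-(1 / 4) : ℂ)‖ := by norm_num
        _ ≤ ‖-x ^ 2 - -(1 / 4)‖ := norm_sub_norm_le _ _
        _ = Q := by congr 1; ring
    nlinarith
  rw [gammaRatio_zero_left_eq_cos_div_sin h₀ h₁ h₂, norm_div, norm_mul, norm_mul, div_pow,
    div_mul_eq_mul_div]
  refine div_le_of_le_mul₀ (by positivity) (by norm_num) ?_
  calc (‖x‖ * ‖Complex.cos (Real.pi * x)‖) ^ 2 * (1 + ‖x‖ ^ 2)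
      = ‖x‖ ^ 2 * ‖Complex.cos (Real.pi * x)‖ ^ 2 * (1 + ‖x‖ ^ 2) := by ring
    _ ≤ ‖x‖ ^ 2 * (2 * S ^ 2) * (2 * ‖x‖ ^ 2) := by
        gcongr
        nlinarith
    _ = 64 / 9 * (S * (3 / 4 * ‖x‖ ^ 2)) ^ 2 := by ring
    _ ≤ 8 * (S * Q) ^ 2 := by
        gcongr
        norm_num

theorem exists_norm_weight_zero_left_mul_le :
    ∃ C : ℝ, ∀ x : ℂ, |x.re| ≤ 1 / 2 → ‖weight 0 x‖ * (1 + ‖x‖ ^ 2) ≤ C := by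
  have hK : IsCompact (Set.Icc (-(1 / 2 : ℝ)) (1 / 2) ×ℂ Set.Icc (-1 : ℝ) 1) :=
    isCompact_Icc.reProdIm isCompact_Icc
  obtain ⟨C, hC⟩ := hK.bddAbove_image (f := fun x => ‖weight 0 x‖ * (1 + ‖x‖ ^ 2)) fun x hx =>
    ((differentiableAt_weight 0 ((abs_le.2 hx.1).trans_lt one_half_lt_one)).continuousAt.norm.mul
      (by fun_prop)).continuousWithinAt
  refine ⟨max C 8, fun x hx => ?_⟩
  rcases le_total |x.im| 1 with him | him
  · exact le_max_of_le_left (hC (Set.mem_image_of_mem _ ⟨abs_le.1 hx, abs_le.1 him⟩))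
  · rw [weight_zero_left, norm_pow]
    exact le_max_of_le_right (norm_gammaRatio_zero_left_sq_mul_le him)

theorem exists_norm_deformedSum_le : ∃ C : ℝ, ∀ x : ℂ, |x.re| ≤ 1 / 2 → ‖deformedSum x‖ ≤ C := by
  obtain ⟨C, hC⟩ := exists_norm_weight_zero_left_mul_le
  refine ⟨27 * C * ∑' n : ℕ, ((n : ℝ) + 1) ^ 3 * (1 / 4) ^ n, fun x hx => ?_⟩
  rw [← tsum_mul_left]
  refine tsum_of_norm_bounded ((summable_geometric_bound 3).mul_left _).hasSum fun n => ?_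
  refine (norm_wzG_le n (hx.trans one_half_lt_one.le)).trans ?_
  gcongr
  exact hC x hx

theorem gammaRatio_succ_half (n : ℕ) : gammaRatio (n + 1) (1 / 2) = 0 := by
  rw [gammaRatio, show (1 : ℂ) - 2 * (1 / 2) = 0 by norm_num,
    ascPochhammer_ne_zero_eval_zero ℂ n.succ_ne_zero]
  ring

theorem gammaRatio_zero_half : gammaRatio 0 (1 / 2) = Real.pi / 2 := by
  rw [gammaRatio_zero_left, show (1 : ℂ) + 1 / 2 = 3 / 2 by norm_num,
    show (1 : ℂ) - 1 / 2 = 1 / 2 by norm_num, show (3 / 2 : ℂ) + 1 / 2 = 1 + 1 by norm_num,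
    show (3 / 2 : ℂ) - 1 / 2 = 1 by norm_num, Complex.Gamma_add_one _ one_ne_zero,
    Complex.Gamma_one, Gamma_three_halves, ← Gamma_one_half_sq]
  ring

theorem deformedSum_half : deformedSum (1 / 2) = Real.pi ^ 2 := by
  rw [deformedSum, tsum_eq_single 0]
  · rw [wzG, weight_zero_left, gammaRatio_zero_half, polyG, Nat.cast_zero]
    ring
  · intro n hn
    obtain ⟨m, rfl⟩ := Nat.exists_eq_succ_of_ne_zero hn
    rw [wzG, weight, gammaRatio_succ_half]
    ring

theorem hasSum_wzG_zero : HasSum (wzG · 0) (Real.pi ^ 2 : ℂ) := by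
  obtain ⟨C, hC⟩ := exists_norm_deformedSum_le
  have hconst : deformedSum 0 = deformedSum (1 / 2) :=
    eq_of_periodic_of_bounded_on_strip (fun z => deformedSum_add_one)
      (fun z => differentiableAt_deformedSum) hC (by norm_num) (by norm_num)
  rw [← deformedSum_half, ← hconst]
  exact (summable_wzG (by norm_num)).hasSum

theorem gammaRatio_zero_right (n : ℕ) :
    gammaRatio n 0 = ((4 / Real.pi * factorialRatio n ^ 2 : ℝ) : ℂ) := by
  have hΓ : Complex.Gamma (n + 3 / 2) = Complex.Gamma (3 / 2) * pochhammerSymbol (3 / 2) n := by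
    rw [Gamma_natCast_add (by norm_num), ofReal_pochhammerSymbol]
    push_cast
    rfl
  have hΓ₂ : Complex.Gamma (3 / 2) ^ 2 = Real.pi / 4 := by
    rw [Gamma_three_halves, div_pow, Gamma_one_half_sq]
    norm_num
  simp only [gammaRatio, mul_zero, add_zero, sub_zero, Complex.Gamma_one, one_mul,
    ascPochhammer_eval_one, hΓ]
  rw [factorialRatio, ← mul_inv]
  push_cast
  calc _ = n.factorial ^ 2 / (Complex.Gamma (3 / 2) ^ 2 * pochhammerSymbol (3 / 2) n ^ 2) := by
        rw [div_eq_mul_inv]; ring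
    _ = _ := by
        rw [hΓ₂, div_pow, ← mul_div_mul_comm]
        field_simp

theorem wzG_zero_right (n : ℕ) :
    wzG n 0 = ((8 / Real.pi ^ 2 *
      (pochhammerSymbol 1 (n + 1) ^ 7 / pochhammerSymbol (1 / 2) (n + 1) ^ 7 *
        (1 / 2 ^ (6 * (n + 1))) *
        ((21 * ((n + 1 : ℕ) : ℝ) ^ 3 - 22 * ((n + 1 : ℕ) : ℝ) ^ 2 + 8 * ((n + 1 : ℕ) : ℝ) - 1) /
          ((n + 1 : ℕ) : ℝ) ^ 7)) : ℝ) : ℂ) := by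
  have h64 : (2 : ℝ) ^ (6 * (n + 1)) = 64 ^ n * 64 := by rw [pow_mul, pow_succ]; norm_num
  have hpoly : polyG n 0 = (((3 * n + 2) * (7 * n ^ 2 + 9 * n + 3) : ℝ) : ℂ) := by
    unfold polyG
    push_cast
    ring
  have hweight : weight n 0 = ((16 / Real.pi ^ 2 * factorialRatio n ^ 7 / 64 ^ n : ℝ) : ℂ) := by
    rw [weight, gammaRatio_zero_right]
    push_cast
    ring
  have := pochhammerSymbol_pos (by norm_num : (0 : ℝ) < 3 / 2) n
  rw [wzG, hweight, hpoly, ← Complex.ofReal_mul, Complex.ofReal_inj, h64, pochhammerSymbol_one,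
    Nat.factorial_succ, pochhammerSymbol_half_succ, factorialRatio]
  push_cast
  field_simp
  ring

end Guillera

theorem mainTheorem3 :
    HasSum
      (fun n : ℕ =>
        pochhammerSymbol (1 / 2) n ^ 7 / pochhammerSymbol 1 n ^ 7 * (1 / 2 ^ (6 * n)) *
          (168 * (n : ℝ) ^ 3 + 76 * (n : ℝ) ^ 2 + 14 * (n : ℝ) + 1))
      (32 / Real.pi ^ 3) ∧
    HasSum
      (fun n : ℕ+ =>
        pochhammerSymbol 1 (n : ℕ) ^ 7 / pochhammerSymbol (1 / 2) (n : ℕ) ^ 7 *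
          (1 / 2 ^ (6 * (n : ℕ))) *
          ((21 * ((n : ℕ) : ℝ) ^ 3 - 22 * ((n : ℕ) : ℝ) ^ 2 + 8 * ((n : ℕ) : ℝ) - 1) /
            ((n : ℕ) : ℝ) ^ 7))
      (Real.pi ^ 4 / 8) := by
  refine ⟨by simpa only [Gourevich.wzG_zero_right] using Gourevich.hasSum_wzG_zero, ?_⟩
  rw [← Equiv.pnatEquivNat.symm.hasSum_iff,
    ← hasSum_mul_left_iff (a₂ := 8 / Real.pi ^ 2) (by positivity), ← Complex.hasSum_ofReal]
  have hsum : ((8 / Real.pi ^ 2 * (Real.pi ^ 4 / 8) : ℝ) : ℂ) = Real.pi ^ 2 := by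
    have hpi : (Real.pi : ℂ) ≠ 0 := by exact_mod_cast Real.pi_ne_zero
    push_cast
    field_simp
  rw [hsum]
  simpa only [Guillera.wzG_zero_right, Function.comp_apply, Equiv.pnatEquivNat_symm_apply,
    Nat.succPNat_coe, Nat.succ_eq_add_one] using Guillera.hasSum_wzG_zero
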